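/- Modules are left modules (for right modules, pass to the opposite ring). An artin algebra is an algebra that is finitely generated as a module over a commutative artinian ring; a ring is semihereditary if every finitely generated submodule of a projective module is projective. A module $X$ is exceptional if $\mathrm{Ext}^n(X,X)=0$ for all $n\geq 1$. A tilting $R$-module is a module $T$ of projective dimension at most one with $\mathrm{Ext}^1_R(T,T^{(I)})=0$ for every set $I$, for which there is an exact sequence $0\to R\to T_0\to T_1\to 0$ with $T_0,T_1$ direct summands of direct sums of copies of $T$. Let $R$ be a semihereditary artin algebra and let $X$ be a finitely presented, exceptional, indecomposable $R$-module. Choose an exact sequence $0\to P\xrightarrow{\alpha} Q\to X\to 0$ with $P,Q$ finitely generated projective. Then the universal localization $\lambda\colon R\to B$ of $R$ at $X$ exists, that is, the universal ring homomorphism for which $B\otimes_R\alpha$ is an isomorphism. View $B$-modules as $R$-modules via $\lambda$. (1) If $X$ is projective, then $B$ is an artin algebra, and the simple $B$-modules are precisely the simple $R$-modules that are not isomorphic to $X/\mathrm{Rad}(X)$: restriction along $\lambda$ induces a bijection between the isomorphism classes of simple $B$-modules and the isomorphism classes of simple $R$-modules not isomorphic to $X/\mathrm{Rad}(X)$. (2)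 If $X$ has projective dimension one, then $B$ is an artin algebra, $B\oplus X$ is a tilting $R$-module, and the $R$-module $B$ is the Bongartz complement of $X$: there is an exact sequence $E\colon 0\to R\to B\to X^{c}\to 0$, where $c$ is the minimal number of generators of $\mathrm{Ext}^1_R(X,R)$ as a module over $\mathrm{End}_R(X)$, such that every extension $0\to R\to N\to X\to 0$ is equivalent to the pullback of $E$ along some homomorphism $X\to X^{c}$. -/

import Mathlib

open CategoryTheory CategoryTheory.Abelian
open scoped TensorProduct

universe u

noncomputable section

/-- `R` is an artin algebra: an algebra over a commutative artinian ring `k` that is finitely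
generated (equivalently, artinian) as a `k`-module. -/
def IsArtinAlgebra (R : Type u) [Ring R] : Prop :=
  ∃ (k : Type u) (_ : CommRing k) (_ : Algebra k R), IsArtinianRing k ∧ Module.Finite k R

/-- `R` is semihereditary: finitely generated submodules of projective modules are projective. -/
def IsSemihereditaryRing (R : Type u) [Ring R] : Prop :=
  ∀ (P : Type u) [AddCommGroup P] [Module R P], Module.Projective R P →
    ∀ N : Submodule R P, N.FG → Module.Projective R N

/-- A module is indecomposable if it is nonzero and is not the direct sum of two nonzero
submodules. -/
def IsIndecomposableModule (R : Type u) [Ring R] (X : Type u) [AddCommGroup X] [Module R X] :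
    Prop :=
  Nontrivial X ∧ ∀ N N' : Submodule R X, IsCompl N N' → N = ⊥ ∨ N' = ⊥

/-- A module is exceptional if it is exceptional as an object of the derived category, that is,
`Hom (X, X[n]) = 0` for all `n ≠ 0`. These groups vanish for negative `n`, and for `n > 0` they are
the groups `Extⁿ (X, X)`. -/
def IsExceptionalModule {R : Type u} [Ring R] (X : ModuleCat.{u} R) : Prop :=
  ∀ n : ℕ, n ≠ 0 → Subsingleton (Ext X X n)

section ScalarExtension

variable {R S : Type u} [Ring R] [Ring S] (f : R →+* S)

/-- The relations `s f(r) ⊗ p = s ⊗ r p` which cut `S ⊗_R P` out of `S ⊗_ℤ P`. -/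
def balancingRelations (P : Type u) [AddCommGroup P] [Module R P] : Submodule S (S ⊗[ℤ] P) :=
  Submodule.span S
    {x | ∃ (s : S) (r : R) (p : P), x = (s * f r) ⊗ₜ[ℤ] p - s ⊗ₜ[ℤ] (r • p)}

/-- The left `S`-module `S ⊗_R P`, for a homomorphism `f : R → S` of (not necessarily commutative)
rings and a left `R`-module `P`. -/
abbrev ScalarExtension (P : Type u) [AddCommGroup P] [Module R P] : Type u :=
  (S ⊗[ℤ] P) ⧸ balancingRelations f P

variable {P Q : Type u} [AddCommGroup P] [Module R P] [AddCommGroup Q] [Module R Q]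

/-- The map `id ⊗ α : S ⊗_R P → S ⊗_R Q`. -/
def scalarExtensionMap (α : P →ₗ[R] Q) : ScalarExtension f P →ₗ[S] ScalarExtension f Q :=
  Submodule.mapQ (balancingRelations f P) (balancingRelations f Q)
    (TensorProduct.AlgebraTensorModule.lTensor S S (α.toAddMonoidHom.toIntLinearMap)) <| by
    rw [balancingRelations, Submodule.span_le]
    rintro _ ⟨s, r, p, rfl⟩
    refine Submodule.subset_span ⟨s, r, α p, ?_⟩
    simp

@[simp]
theorem scalarExtensionMap_mk_tmul (α : P →ₗ[R] Q) (s : S) (p : P) :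
    scalarExtensionMap f α (Submodule.Quotient.mk (s ⊗ₜ[ℤ] p)) =
      Submodule.Quotient.mk (s ⊗ₜ[ℤ] α p) := by
  simp [scalarExtensionMap]

/-- `f : R → S` is `α`-inverting: `S ⊗_R α` is an isomorphism. -/
def IsInverting (α : P →ₗ[R] Q) : Prop :=
  Function.Bijective (scalarExtensionMap f α)

/-- `f : R → S` is the universal localization of `R` at `{α}`: it is `α`-inverting, and every
`α`-inverting ring homomorphism factors uniquely through it. -/
def IsUniversalLocalization (α : P →ₗ[R] Q) : Prop :=
  IsInverting f α ∧
    ∀ (A : Type u) [Ring A] (ψ : R →+* A), IsInverting ψ α → ∃! φ : S →+* A, φ.comp f = ψ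

end ScalarExtension

/-- `M` belongs to `Add T`: it is a direct summand of a direct sum of copies of `T`. -/
def InAdd {R : Type u} [Ring R] (T M : ModuleCat.{u} R) : Prop :=
  ∃ (I : Type u) (i : M →ₗ[R] (I →₀ T)) (p : (I →₀ T) →ₗ[R] M), p ∘ₗ i = LinearMap.id

/-- Tilting modules of projective dimension at most one. -/
structure IsTiltingModule {R : Type u} [Ring R] (T : ModuleCat.{u} R) : Prop where
  projDim_le_one : HasProjectiveDimensionLE T 1
  ext_eq_zero : ∀ I : Type u, Subsingleton (Ext T (ModuleCat.of R (I →₀ T)) 1)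
  exists_coresolution : ∃ (T₀ T₁ : ModuleCat.{u} R) (i : R →ₗ[R] T₀) (p : T₀ →ₗ[R] T₁),
    InAdd T T₀ ∧ InAdd T T₁ ∧
      Function.Injective i ∧ Function.Exact i p ∧ Function.Surjective p

/-- The family `e` generates `Ext¹ (X, Y)` as a module over `End X`, which acts by
precomposition. -/
def GeneratesExtOverEnd {R : Type u} [Ring R] (X Y : ModuleCat.{u} R) {c : ℕ}
    (e : Fin c → Ext X Y 1) : Prop :=
  ∀ x : Ext X Y 1, ∃ f : Fin c → (X ⟶ X), x = ∑ i, (Ext.mk₀ (f i)).comp (e i) (zero_add 1)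

/-- `M` is the Bongartz complement of `X`: it is the middle term of a short exact sequence
`E : 0 → R → M → X^c → 0`, with `c` the minimal number of generators of `Ext¹ (X, R)` over `End X`,
such that every extension of `X` by `R` has the form `E f`, the pullback of `E` along a
homomorphism `f : X → X^c`. -/
def IsBongartzComplement {R : Type u} [Ring R] (X M : ModuleCat.{u} R) : Prop :=
  ∃ (c : ℕ) (i : ModuleCat.of R R ⟶ M) (p : M ⟶ ModuleCat.of R (Fin c → X)) (w : i ≫ p = 0)
    (hE : (ShortComplex.mk i p w).ShortExact),
    IsLeast {n : ℕ | ∃ e : Fin n → Ext X (ModuleCat.of R R) 1,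
      GeneratesExtOverEnd X (ModuleCat.of R R) e} c ∧
    ∀ x : Ext X (ModuleCat.of R R) 1, ∃ f : X ⟶ ModuleCat.of R (Fin c → X),
      x = (Ext.mk₀ f).comp hE.extClass (zero_add 1)

end

/-! Call `Y` perpendicular if `Hom(Q, Y) → Hom(P, Y)` is bijective, that is, `Hom(X, Y) = 0 =
Ext¹(X, Y)`. As `P` and `Q` are finitely generated projective, a ring map `R → A` inverts `α`
exactly when `A` is perpendicular over `R`. So a reflection `E` of `R` into the perpendicular
modules gives the localization: it is `End_R(E)ᵒᵖ`, which is `E` as an `R`-module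
(`IsReflection.isUniversalLocalization`), and it is an artin algebra once `E` is finitely generated.

It remains to find `E`. If `X` is projective, `E` is `R` modulo the trace of `X`, and the simples
are controlled by the unique maximal submodule of `X`. Otherwise `Hom(X, R) = 0` and `End X` is a
division ring (Happel–Ringel, `IsSemihereditaryRing.bijective_of_ne_zero`), so a minimal generating
family of `Ext¹(X, R)` is a basis. Take the extension `M` of `X^c` by `R` with this class:
independence kills `Hom(X, M)` and generation kills `Ext¹(X, M)`. This extension is both the
Bongartz sequence and the tilting coresolution. -/

noncomputable section

/-! ### Perpendicular modules and inverting homomorphisms -/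

section Perpendicular

variable {R S : Type u} [Ring R] [Ring S] {P Q : Type u} [AddCommGroup P] [Module R P]
  [AddCommGroup Q] [Module R Q]

/-- `Y` is right perpendicular to `α` along `f : R → S`: every `f`-semilinear map `P → Y` extends
uniquely along `α` to `Q`. -/
def IsPerpendicular (f : R →+* S) (α : P →ₗ[R] Q) (Y : Type u) [AddCommGroup Y] [Module S Y] :
    Prop :=
  ∀ g : P →ₛₗ[f] Y, ∃! h : Q →ₛₗ[f] Y, ∀ p, h (α p) = g p

variable {f : R →+* S} {α : P →ₗ[R] Q} {Y Z : Type u} [AddCommGroup Y] [Module S Y]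
  [AddCommGroup Z] [Module S Z]

theorem IsPerpendicular.hom_ext (hY : IsPerpendicular f α Y) {h₁ h₂ : Q →ₛₗ[f] Y}
    (h : ∀ p, h₁ (α p) = h₂ (α p)) : h₁ = h₂ :=
  (hY (h₂.comp α)).unique h fun _ => rfl

theorem IsPerpendicular.of_retract (hY : IsPerpendicular f α Y) (s : Z →ₗ[S] Y) (r : Y →ₗ[S] Z)
    (hrs : ∀ z, r (s z) = z) : IsPerpendicular f α Z := by
  intro g
  obtain ⟨h, hh, -⟩ := hY (s.comp g)
  refine ⟨r.comp h, fun p => by simp [hh, hrs], fun h' hh' => ?_⟩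
  have : s.comp h' = h := hY.hom_ext fun p => by simp [hh, hh']
  ext q
  simp [← this, hrs]

theorem IsPerpendicular.pi {ι : Type} (hY : IsPerpendicular f α Y) :
    IsPerpendicular f α (ι → Y) := by
  intro g
  choose h hh _ using fun i : ι => hY ((LinearMap.proj (R := S) i).comp g)
  refine ⟨{ toFun := fun q i => h i q, map_add' := ?_, map_smul' := ?_ }, ?_, ?_⟩
  · intro x y; ext i; simp
  · intro r x; ext i; simp
  · intro p; ext i; simp [hh]
  · intro h' hh'
    ext q i
    have : (LinearMap.proj (R := S) (φ := fun _ : ι => Y) i).comp h' = h i :=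
      hY.hom_ext fun p => by simp [hh, hh']
    simp [← this]

variable (f) in
/-- The canonical map `P → S ⊗_R P`. -/
def scalarExtensionUnit (P : Type u) [AddCommGroup P] [Module R P] :
    P →ₛₗ[f] ScalarExtension f P where
  toFun p := Submodule.Quotient.mk (1 ⊗ₜ p)
  map_add' x y := by rw [TensorProduct.tmul_add, Submodule.Quotient.mk_add]
  map_smul' r x := by
    rw [← Submodule.Quotient.mk_smul, eq_comm, Submodule.Quotient.eq]
    refine Submodule.subset_span ⟨1, r, x, ?_⟩
    rw [TensorProduct.smul_tmul', smul_eq_mul, mul_one, one_mul]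

theorem scalarExtension_hom_ext {h₁ h₂ : ScalarExtension f P →ₗ[S] Y}
    (h : ∀ p, h₁ (scalarExtensionUnit f P p) = h₂ (scalarExtensionUnit f P p)) : h₁ = h₂ := by
  refine Submodule.linearMap_qext _ (TensorProduct.AlgebraTensorModule.ext fun s p => ?_)
  have : s ⊗ₜ[ℤ] p = s • ((1 : S) ⊗ₜ[ℤ] p) := by
    rw [TensorProduct.smul_tmul', smul_eq_mul, mul_one]
  rw [this, map_smul, map_smul]
  exact congrArg (s • ·) (h p)

/-- A semilinear map `P → Y` extends to a linear map `S ⊗_R P → Y`. -/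
def scalarExtensionLift (g : P →ₛₗ[f] Y) : ScalarExtension f P →ₗ[S] Y :=
  Submodule.liftQ _ (TensorProduct.AlgebraTensorModule.lift
    (LinearMap.toSpanSingleton S (P →ₗ[ℤ] Y) g.toAddMonoidHom.toIntLinearMap)) <| by
    rw [balancingRelations, Submodule.span_le]
    rintro _ ⟨s, r, p, rfl⟩
    simp [mul_smul]

@[simp]
theorem scalarExtensionLift_unit (g : P →ₛₗ[f] Y) (p : P) :
    scalarExtensionLift g (scalarExtensionUnit f P p) = g p := by
  simp [scalarExtensionLift, scalarExtensionUnit]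

theorem scalarExtensionMap_unit (p : P) :
    scalarExtensionMap f α (scalarExtensionUnit f P p) = scalarExtensionUnit f Q (α p) :=
  scalarExtensionMap_mk_tmul f α 1 p

/-- `S ⊗_R M` is a retract of some `Sⁿ`, and perpendicularity passes to finite powers and retracts.
-/
theorem IsPerpendicular.scalarExtension (h : IsPerpendicular f α S) (M : Type u) [AddCommGroup M]
    [Module R M] [Module.Finite R M] [Module.Projective R M] :
    IsPerpendicular f α (ScalarExtension f M) := by
  obtain ⟨n, p, i, -, -, hpi⟩ := Module.Finite.exists_comp_eq_id_of_projective R M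
  let j : M →ₛₗ[f] (Fin n → S) :=
    { toFun := fun m k => f (i m k)
      map_add' := fun x y => by ext k; simp
      map_smul' := fun r x => by ext k; simp }
  let r : (Fin n → S) →ₗ[S] ScalarExtension f M :=
    ∑ k, (LinearMap.toSpanSingleton S _ (scalarExtensionUnit f M (p (Pi.single k 1)))).comp
      (LinearMap.proj k)
  have hr : r.comp (scalarExtensionLift j) = LinearMap.id := by
    refine scalarExtension_hom_ext fun m => ?_
    have hm : m = ∑ k, i m k • p (Pi.single k 1) := by
      conv_lhs => rw [← LinearMap.id_apply (R := R) m, ← hpi, LinearMap.comp_apply,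
        ← LinearMap.sum_single_apply (fun _ : Fin n => R) (i m)]
      rw [map_sum]
      refine Finset.sum_congr rfl fun k _ => ?_
      rw [← map_smul]
      congr 1
      ext l
      by_cases hl : l = k
      · subst hl; simp
      · simp [hl]
    conv_rhs => rw [hm]
    simp [r, j]
  exact h.pi.of_retract (scalarExtensionLift j) r fun z => LinearMap.congr_fun hr z

/-- Adjunction: semilinear maps `P → Y` are `S`-linear maps `S ⊗_R P → Y`. -/
theorem IsInverting.isPerpendicular (h : IsInverting f α) : IsPerpendicular f α Y := by
  let e := LinearEquiv.ofBijective (scalarExtensionMap f α) h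
  have he : ∀ p, e (scalarExtensionUnit f P p) = scalarExtensionUnit f Q (α p) :=
    scalarExtensionMap_unit
  intro g
  refine ⟨((scalarExtensionLift g).comp e.symm.toLinearMap).comp (scalarExtensionUnit f Q),
    fun p => by simp [← he], fun h' hh' => ?_⟩
  have : (scalarExtensionLift h').comp e.toLinearMap = scalarExtensionLift g :=
    scalarExtension_hom_ext fun p => by simp [he, hh']
  ext q
  simp [← this]

theorem isInverting_of_isPerpendicular [Module.Finite R P] [Module.Projective R P]
    [Module.Finite R Q] [Module.Projective R Q] (h : IsPerpendicular f α S) :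
    IsInverting f α := by
  -- Yoneda argument: extending the unit of `P` along `α` produces the inverse of `S ⊗ α`.
  obtain ⟨β, hβ, -⟩ := h.scalarExtension P (scalarExtensionUnit f P)
  have h₁ : (scalarExtensionLift β).comp (scalarExtensionMap f α) = LinearMap.id :=
    scalarExtension_hom_ext fun p => by simp [scalarExtensionMap_unit, hβ]
  have h₂ : (scalarExtensionMap f α).comp (scalarExtensionLift β) = LinearMap.id := by
    have : (scalarExtensionMap f α).comp β = scalarExtensionUnit f Q :=
      (h.scalarExtension Q).hom_ext fun p => by simp [scalarExtensionMap_unit, hβ]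
    exact scalarExtension_hom_ext fun q => by simpa using LinearMap.congr_fun this q
  exact Function.bijective_iff_has_inverse.2 ⟨scalarExtensionLift β,
    fun x => LinearMap.congr_fun h₁ x, fun x => LinearMap.congr_fun h₂ x⟩

/-- Perpendicularity only depends on the underlying `R`-module. -/
theorem IsPerpendicular.of_addEquiv {T : Type u} [Ring T] {f' : R →+* T} {W : Type u}
    [AddCommGroup W] [Module T W] (hY : IsPerpendicular f α Y) (e : Y ≃+ W)
    (he : ∀ (r : R) (y : Y), e (f r • y) = f' r • e y) : IsPerpendicular f' α W := by
  have he' : ∀ (r : R) (w : W), e.symm (f' r • w) = f r • e.symm w := fun r w => by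
    rw [e.symm_apply_eq, he, e.apply_symm_apply]
  intro g
  obtain ⟨h, hh, -⟩ := hY
    { toFun := fun p => e.symm (g p)
      map_add' := fun x y => by simp
      map_smul' := fun r x => by simp [he'] }
  refine ⟨{ toFun := fun q => e (h q)
            map_add' := fun x y => by simp
            map_smul' := fun r x => by simp [he] }, fun p => by simp [hh], fun h' hh' => ?_⟩
  have : ({ toFun := fun q => e.symm (h' q)
            map_add' := fun x y => by simp
            map_smul' := fun r x => by simp [he'] } : Q →ₛₗ[f] Y) = h :=
    hY.hom_ext fun p => by simp [hh, hh']
  ext q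
  simp [← this]

end Perpendicular

/-! ### The localization as the opposite endomorphism ring of a reflection -/

section Reflection

variable {R : Type u} [Ring R] {P Q : Type u} [AddCommGroup P] [Module R P]
  [AddCommGroup Q] [Module R Q]

/-- The element `η` of `E` exhibits `E` as the reflection of `R` into the category of modules which
are right perpendicular to `α`. -/
structure IsReflection (α : P →ₗ[R] Q) {E : Type u} [AddCommGroup E] [Module R E] (η : E) :
    Prop where
  isPerpendicular : IsPerpendicular (RingHom.id R) α E
  exists_lift : ∀ (Y : Type u) [AddCommGroup Y] [Module R Y],
    IsPerpendicular (RingHom.id R) α Y → ∀ y : Y, ∃ h : E →ₗ[R] Y, h η = y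
  hom_ext : ∀ (Y : Type u) [AddCommGroup Y] [Module R Y],
    IsPerpendicular (RingHom.id R) α Y → ∀ h₁ h₂ : E →ₗ[R] Y, h₁ η = h₂ η → h₁ = h₂

variable {α : P →ₗ[R] Q} {E : Type u} [AddCommGroup E] [Module R E] {η : E}

namespace IsReflection

variable (hE : IsReflection α η)
include hE

theorem endHom_ext {a b : Module.End R E} (h : a η = b η) : a = b :=
  hE.hom_ext E hE.isPerpendicular a b h

/-- The endomorphism of the reflection of `R` with a given value at the unit. -/
def toEnd (x : E) : Module.End R E := (hE.exists_lift E hE.isPerpendicular x).choose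

@[simp]
theorem toEnd_apply (x : E) : hE.toEnd x η = x :=
  (hE.exists_lift E hE.isPerpendicular x).choose_spec

/-- The ring homomorphism from `R` to the opposite of the endomorphism ring of its reflection. -/
def toEndOp : R →+* (Module.End R E)ᵐᵒᵖ where
  -- Composing the endomorphisms for `r` and `s` sends `η` to `(s * r) • η`, hence the opposite
  -- ring.
  toFun r := MulOpposite.op (hE.toEnd (r • η))
  map_one' := MulOpposite.unop_injective (hE.endHom_ext (by simp))
  map_zero' := MulOpposite.unop_injective (hE.endHom_ext (by simp))
  map_add' x y := MulOpposite.unop_injective (hE.endHom_ext (by simp [add_smul]))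
  map_mul' x y := MulOpposite.unop_injective (hE.endHom_ext (by simp [mul_smul]))

/-- Evaluation at the unit. -/
def endOpEquiv : (Module.End R E)ᵐᵒᵖ ≃+ E where
  toFun b := b.unop η
  invFun x := MulOpposite.op (hE.toEnd x)
  left_inv b := MulOpposite.unop_injective (hE.endHom_ext (by simp))
  right_inv x := by simp
  map_add' x y := by simp

theorem endOpEquiv_smul (r : R) (b : (Module.End R E)ᵐᵒᵖ) :
    hE.endOpEquiv (hE.toEndOp r * b) = r • hE.endOpEquiv b := by
  simp [endOpEquiv, toEndOp]

/-- Evaluation at `η` makes the ring perpendicular, so `α` is inverted. Any inverting `A` is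
perpendicular too, so a unique `R`-linear map `E → A` sends `η` to `1`; it is the required
factorization. -/
theorem isUniversalLocalization [Module.Finite R P] [Module.Projective R P]
    [Module.Finite R Q] [Module.Projective R Q] : IsUniversalLocalization hE.toEndOp α := by
  have hB : IsPerpendicular hE.toEndOp α (Module.End R E)ᵐᵒᵖ := by
    refine hE.isPerpendicular.of_addEquiv hE.endOpEquiv.symm fun r y => ?_
    rw [AddEquiv.symm_apply_eq, smul_eq_mul, endOpEquiv_smul, AddEquiv.apply_symm_apply]
    rfl
  refine ⟨isInverting_of_isPerpendicular hB, fun A _ ψ hψ => ?_⟩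
  let : Module R A := Module.compHom A ψ
  have smul_def : ∀ (r : R) (a : A), r • a = ψ r * a := fun _ _ => rfl
  have hA : IsPerpendicular (RingHom.id R) α A :=
    (hψ.isPerpendicular (Y := A)).of_addEquiv (AddEquiv.refl A) fun _ _ => rfl
  obtain ⟨φ, hφ⟩ := hE.exists_lift A hA 1
  -- Both sides are `R`-linear in `x` and agree at `η`; this yields multiplicativity.
  have hφb : ∀ (b : Module.End R E) (x : E), φ (b x) = φ x * φ (b η) := by
    intro b x
    let m : A →ₗ[R] A :=
      { toFun := fun a => a * φ (b η)
        map_add' := fun x y => add_mul x y _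
        map_smul' := fun r x => mul_assoc (ψ r) x _ }
    have : φ.comp b = m.comp φ := hE.hom_ext A hA _ _ (by simp [m, hφ])
    exact LinearMap.congr_fun this x
  refine ⟨{ toFun := fun b => φ (b.unop η), map_one' := ?_, map_mul' := ?_,
            map_zero' := ?_, map_add' := ?_ }, ?_, ?_⟩
  · simpa using hφ
  · intro x y
    simpa using hφb y.unop (x.unop η)
  · simp
  · intro x y
    simp
  · ext r
    simp [toEndOp, hφ, smul_def]
  · intro φ' hφ'
    let h : E →ₗ[R] A :=
      { toFun := fun x => φ' (hE.endOpEquiv.symm x)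
        map_add' := fun x y => by simp
        map_smul' := fun r x => by
          have : hE.endOpEquiv.symm (r • x) = hE.toEndOp r * hE.endOpEquiv.symm x := by
            rw [AddEquiv.symm_apply_eq, endOpEquiv_smul, AddEquiv.apply_symm_apply]
          rw [this, map_mul, RingHom.id_apply, smul_def, ← hφ']
          rfl }
    have h1 : hE.endOpEquiv.symm η = 1 := by
      rw [AddEquiv.symm_apply_eq]
      rfl
    have hh : h = φ := hE.hom_ext A hA _ _ (by simp [h, h1, hφ])
    ext b
    change φ' b = φ (hE.endOpEquiv b)
    rw [← hh]
    exact congrArg φ' (hE.endOpEquiv.symm_apply_apply b).symm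

end IsReflection

variable {B : Type u} [Ring B] {l : R →+* B}

theorem IsUniversalLocalization.exists_ringEquiv {C : Type u} [Ring C] {m : R →+* C}
    (hl : IsUniversalLocalization l α) (hm : IsUniversalLocalization m α) :
    ∃ e : B ≃+* C, ∀ r, e (l r) = m r := by
  obtain ⟨φ, hφ, -⟩ := hl.2 C m hm.1
  obtain ⟨χ, hχ, -⟩ := hm.2 B l hl.1
  have h₁ : χ.comp φ = RingHom.id B :=
    (hl.2 B l hl.1).unique (by rw [RingHom.comp_assoc, hφ, hχ]) (RingHom.id_comp l)
  have h₂ : φ.comp χ = RingHom.id C :=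
    (hm.2 C m hm.1).unique (by rw [RingHom.comp_assoc, hχ, hφ]) (RingHom.id_comp m)
  exact ⟨RingEquiv.ofRingHom φ χ h₂ h₁, fun r => RingHom.congr_fun hφ r⟩

/-- The universal localization, as an `R`-module, is the reflection of `R`. -/
theorem IsReflection.exists_addEquiv [Module.Finite R P] [Module.Projective R P]
    [Module.Finite R Q] [Module.Projective R Q] (hE : IsReflection α η)
    (hl : IsUniversalLocalization l α) :
    ∃ e : B ≃+ E, (∀ r b, e (l r * b) = r • e b) ∧ e 1 = η := by
  obtain ⟨e, he⟩ := hl.exists_ringEquiv hE.isUniversalLocalization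
  refine ⟨e.toAddEquiv.trans hE.endOpEquiv, fun r b => ?_, ?_⟩
  · simp [he, hE.endOpEquiv_smul]
  · simp [IsReflection.endOpEquiv]

/-- The universal localization of an artin algebra is an artin algebra, provided that it is
finitely generated over `R`. -/
theorem IsReflection.isArtinAlgebra [Module.Finite R P] [Module.Projective R P]
    [Module.Finite R Q] [Module.Projective R Q] (hR : IsArtinAlgebra R) [Module.Finite R E]
    (hE : IsReflection α η) (hl : IsUniversalLocalization l α) : IsArtinAlgebra B := by
  obtain ⟨k, _, _, hk, _⟩ := hR
  obtain ⟨e, he, he1⟩ := hE.exists_addEquiv hl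
  -- Since `a` is central in `R`, left and right multiplication by its image are both `R`-linear on
  -- `B`; they agree at `1`, so they are equal by the reflection property.
  have hcomm : ∀ (a : k) (b : B), l (algebraMap k R a) * b = b * l (algebraMap k R a) := by
    intro a b
    let : Module R B := Module.compHom B l
    have hB : IsPerpendicular (RingHom.id R) α B :=
      (hl.1.isPerpendicular (Y := B)).of_addEquiv (AddEquiv.refl B) fun _ _ => rfl
    let e' : E →ₗ[R] B :=
      { toFun := e.symm
        map_add' := fun x y => map_add e.symm x y
        map_smul' := fun r x => by
          rw [AddEquiv.symm_apply_eq, RingHom.id_apply]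
          exact (by rw [he, e.apply_symm_apply] : r • x = e (l r * e.symm x)) }
    let m₁ : E →ₗ[R] B :=
      { toFun := fun x => l (algebraMap k R a) * e' x
        map_add' := fun x y => by rw [map_add, mul_add]
        map_smul' := fun r x => by
          change _ = l r * _
          rw [map_smul]
          change _ * (l r * _) = _
          rw [← mul_assoc, ← mul_assoc, ← map_mul, ← map_mul, Algebra.commutes] }
    let m₂ : E →ₗ[R] B :=
      { toFun := fun x => e' x * l (algebraMap k R a)
        map_add' := fun x y => by rw [map_add, add_mul]
        map_smul' := fun r x => by
          rw [map_smul]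
          exact mul_assoc (l r) _ _ }
    have h1 : e' η = 1 := by
      change e.symm η = 1
      rw [← he1, e.symm_apply_apply]
    have : m₁ = m₂ := hE.hom_ext B hB _ _ (by simp [m₁, m₂, h1])
    simpa [m₁, m₂, e'] using LinearMap.congr_fun this (e b)
  let : Algebra k B := (l.comp (algebraMap k R)).toAlgebra' hcomm
  refine ⟨k, inferInstance, inferInstance, hk, ?_⟩
  let : Module k E := Module.compHom E (algebraMap k R)
  have : IsScalarTower k R E := ⟨fun a r x => by
    rw [Algebra.smul_def, mul_smul]
    rfl⟩
  have : Module.Finite k E := Module.Finite.trans R E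
  let e' : E ≃ₗ[k] B := LinearEquiv.symm
    { e with
      map_smul' := fun a b => by
        rw [Algebra.smul_def]
        exact he _ _ }
  exact Module.Finite.equiv e'

end Reflection

/-! ### Fitting's lemma and the top of an indecomposable projective -/

section Indecomposable

variable {R : Type u} [Ring R] {X : Type u} [AddCommGroup X] [Module R X]

/-- Fitting's lemma: endomorphisms of indecomposable modules of finite length are bijective or
nilpotent. -/
theorem IsIndecomposableModule.bijective_or_isNilpotent [IsNoetherian R X] [IsArtinian R X]
    (hX : IsIndecomposableModule R X) (θ : Module.End R X) :
    Function.Bijective θ ∨ IsNilpotent θ := by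
  obtain ⟨n, hn⟩ := Filter.eventually_atTop.1 θ.eventually_isCompl_ker_pow_range_pow
  -- The exponent must be positive, so that injectivity of the power gives injectivity of `θ`.
  have hc := hn (n + 1) n.le_succ
  rcases hX.2 _ _ hc with h | h
  · left
    refine IsArtinian.bijective_of_injective_endomorphism θ ?_
    rw [LinearMap.ker_eq_bot, pow_succ] at h
    exact Function.Injective.of_comp h
  · exact Or.inr ⟨n + 1, LinearMap.range_eq_bot.1 h⟩

/-- An indecomposable projective module of finite length has a unique maximal submodule. -/
theorem IsIndecomposableModule.eq_jacobson [IsNoetherian R X] [IsArtinian R X]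
    [Module.Projective R X] (hX : IsIndecomposableModule R X) {M : Submodule R X}
    (hM : IsCoatom M) : M = Module.jacobson R X := by
  -- `M` is superfluous: projectivity lifts `X → X/M` to an endomorphism `θ` with values in `N`. It
  -- is the identity modulo `M ≠ ⊤`, hence not nilpotent, hence bijective.
  have key : ∀ N : Submodule R X, M ⊔ N = ⊤ → N = ⊤ := by
    intro N hMN
    have hsurj : Function.Surjective (M.mkQ ∘ₗ N.subtype) := by
      intro y
      obtain ⟨x, rfl⟩ := M.mkQ_surjective y
      obtain ⟨m, hm, n, hn, rfl⟩ := Submodule.mem_sup.1 (hMN ▸ Submodule.mem_top : x ∈ M ⊔ N)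
      refine ⟨⟨n, hn⟩, ?_⟩
      simpa using hm
    obtain ⟨g, hg⟩ := Module.projective_lifting_property (M.mkQ ∘ₗ N.subtype) M.mkQ hsurj
    let θ : Module.End R X := N.subtype ∘ₗ g
    have hθ : ∀ x, M.mkQ (θ x) = M.mkQ x := fun x => LinearMap.congr_fun hg x
    rcases hX.bijective_or_isNilpotent θ with h | ⟨n, h⟩
    · rw [eq_top_iff]
      rintro x -
      obtain ⟨y, rfl⟩ := h.2 x
      exact (g y).2
    · refine absurd (eq_top_iff.2 fun x _ => ?_) hM.1
      have hpow : ∀ (m : ℕ) (x : X), M.mkQ ((θ ^ m) x) = M.mkQ x := by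
        intro m
        induction m with
        | zero => simp
        | succ m ih =>
          intro x
          rw [pow_succ, Module.End.mul_apply, ih, hθ]
      rw [← Submodule.Quotient.mk_eq_zero]
      exact (hpow n x).symm.trans (by rw [h]; simp)
  refine le_antisymm (le_sInf fun N hN => ?_) (sInf_le hM)
  by_contra hMN
  exact hN.1 (key N (hM.2 _ (left_lt_sup.2 fun h => hMN
    ((hN.le_iff.1 h).elim (fun h => absurd h hM.1) fun h => h.le))))

end Indecomposable

/-! ### Projective `X`: the quotient by the trace ideal -/

section ProjectiveCase

variable {R : Type u} [Ring R] {P Q X : Type u} [AddCommGroup P] [Module R P]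
  [AddCommGroup Q] [Module R Q] [AddCommGroup X] [Module R X] {α : P →ₗ[R] Q} {π : Q →ₗ[R] X}

theorem IsPerpendicular.hom_eq_zero {Y : Type u} [AddCommGroup Y] [Module R Y]
    (hY : IsPerpendicular (RingHom.id R) α Y) (hαπ : Function.Exact α π)
    (hπ : Function.Surjective π) (h : X →ₗ[R] Y) : h = 0 := by
  have : h ∘ₗ π = 0 := hY.hom_ext fun p => by simp [hαπ.apply_apply_eq_zero]
  ext x
  obtain ⟨q, rfl⟩ := hπ x
  exact LinearMap.congr_fun this q

theorem isPerpendicular_of_projective [Module.Projective R X] (hα : Function.Injective α)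
    (hαπ : Function.Exact α π) (hπ : Function.Surjective π) {Y : Type u} [AddCommGroup Y]
    [Module R Y] (hY : ∀ h : X →ₗ[R] Y, h = 0) : IsPerpendicular (RingHom.id R) α Y := by
  obtain ⟨s, hs⟩ := Module.projective_lifting_property π LinearMap.id hπ
  have hs' : ∀ x, π (s x) = x := fun x => LinearMap.congr_fun hs x
  have hker : ∀ q, ∃ p, α p = q - s (π q) := fun q => (hαπ _).1 (by simp [hs'])
  -- The splitting gives `Q = α(P) ⊕ s(X)`; maps to `Y` vanish on `s(X)`, so restriction along `α`
  -- is bijective.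
  let ρ : Q →ₗ[R] P := (LinearEquiv.ofInjective α hα).symm.toLinearMap ∘ₗ
    LinearMap.codRestrict (LinearMap.range α) (LinearMap.id - s ∘ₗ π) hker
  have hαρ : ∀ q, α (ρ q) = q - s (π q) := fun q =>
    congrArg Subtype.val ((LinearEquiv.ofInjective α hα).apply_symm_apply
      (LinearMap.codRestrict (LinearMap.range α) (LinearMap.id - s ∘ₗ π) hker q))
  have hρα : ∀ p, ρ (α p) = p := fun p => hα (by simp [hαρ, hαπ.apply_apply_eq_zero])
  refine fun g => ⟨g ∘ₗ ρ, fun p => by simp [hρα], fun h hh => ?_⟩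
  ext q
  have h0 : h (s (π q)) = 0 := LinearMap.congr_fun (hY (h ∘ₗ s)) (π q)
  simp [← hh, hαρ, h0]

/-- If `X` is projective, then the quotient of `R` by the trace of `X` is the reflection. -/
theorem exists_isReflection_of_projective [Module.Projective R X] (hα : Function.Injective α)
    (hαπ : Function.Exact α π) (hπ : Function.Surjective π) :
    IsReflection α ((⨆ g : X →ₗ[R] R, LinearMap.range g).mkQ 1) where
  isPerpendicular := by
    refine isPerpendicular_of_projective hα hαπ hπ fun h => ?_
    obtain ⟨g, rfl⟩ := Module.projective_lifting_property _ h (Submodule.mkQ_surjective _)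
    ext x
    exact (Submodule.Quotient.mk_eq_zero _).2
      (le_iSup (fun g : X →ₗ[R] R => LinearMap.range g) g ⟨x, rfl⟩)
  exists_lift Y _ _ hY y := by
    refine ⟨Submodule.liftQ _ (LinearMap.toSpanSingleton R Y y) (iSup_le fun g => ?_), by simp⟩
    rintro _ ⟨x, rfl⟩
    exact LinearMap.congr_fun
      (hY.hom_eq_zero hαπ hπ (LinearMap.toSpanSingleton R Y y ∘ₗ g)) x
  hom_ext Y _ _ hY h₁ h₂ h := Submodule.linearMap_qext _ (LinearMap.ext_ring h)

variable {B : Type u} [Ring B] {l : R →+* B} [Module.Finite R P] [Module.Projective R P]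
  [Module.Finite R Q] [Module.Projective R Q]

theorem IsUniversalLocalization.surjective_of_projective [Module.Projective R X]
    (hα : Function.Injective α) (hαπ : Function.Exact α π) (hπ : Function.Surjective π)
    (hl : IsUniversalLocalization l α) : Function.Surjective l := by
  obtain ⟨e, he, he1⟩ := (exists_isReflection_of_projective hα hαπ hπ).exists_addEquiv hl
  intro b
  obtain ⟨r, hr⟩ := Submodule.mkQ_surjective _ (e b)
  refine ⟨r, e.injective ?_⟩
  rw [← mul_one (l r), he, he1, ← hr, ← map_smul, smul_eq_mul, mul_one]

/-- The action of `R` on a right perpendicular module extends to the universal localization. -/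
theorem IsUniversalLocalization.exists_action [Module.Projective R X]
    (hα : Function.Injective α) (hαπ : Function.Exact α π) (hπ : Function.Surjective π)
    (hl : IsUniversalLocalization l α) {Y : Type u} [AddCommGroup Y] [Module R Y]
    (hY : ∀ h : X →ₗ[R] Y, h = 0) : ∃ φ : B →+* AddMonoid.End Y, ∀ r y, φ (l r) y = r • y := by
  let ψ : R →+* AddMonoid.End Y := Module.toAddMonoidEnd R Y
  let : Module R (AddMonoid.End Y) := Module.compHom _ ψ
  -- `R` acts by postcomposition, so evaluating at each `y` reduces to `Hom(X, Y) = 0`. Then `ψ`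
  -- inverts `α`.
  have hA : IsPerpendicular (RingHom.id R) α (AddMonoid.End Y) := by
    refine isPerpendicular_of_projective hα hαπ hπ fun h => ?_
    ext x y
    exact LinearMap.congr_fun (hY
      { toFun := fun x => h x y
        map_add' := fun x x' => by rw [map_add]; rfl
        map_smul' := fun r x => by rw [map_smul]; rfl }) x
  have hψ : IsPerpendicular ψ α (AddMonoid.End Y) :=
    hA.of_addEquiv (AddEquiv.refl _) fun _ _ => rfl
  obtain ⟨φ, hφ, -⟩ := hl.2 _ ψ (isInverting_of_isPerpendicular hψ)
  exact ⟨φ, fun r y => congrArg (fun f : AddMonoid.End Y => f y) (RingHom.congr_fun hφ r)⟩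

end ProjectiveCase

/-! ### Simple modules over the localization -/

section Simple

variable {R : Type u} [Ring R] {B : Type u} [Ring B] {l : R →+* B}

/-- Restriction along a surjective ring homomorphism preserves and reflects simplicity. -/
theorem isSimpleModule_restrictScalars_iff (hl : Function.Surjective l) (S : ModuleCat.{u} B) :
    IsSimpleModule R ((ModuleCat.restrictScalars l).obj S) ↔ IsSimpleModule B S := by
  have : RingHomSurjective l := ⟨hl⟩
  let i : (ModuleCat.restrictScalars l).obj S →ₛₗ[l] S :=
    { toFun := fun x => x
      map_add' := fun _ _ => rfl
      map_smul' := fun _ _ => rfl }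
  exact LinearMap.isSimpleModule_iff_of_bijective i Function.bijective_id

variable {P Q X : Type u} [AddCommGroup P] [Module R P] [AddCommGroup Q] [Module R Q]
  [AddCommGroup X] [Module R X] {α : P →ₗ[R] Q} {π : Q →ₗ[R] X}
  [Module.Finite R P] [Module.Projective R P] [Module.Finite R Q] [Module.Projective R Q]

/-- A simple module which is not the top of the indecomposable projective module `X` admits no
nonzero homomorphism from `X`. -/
theorem IsIndecomposableModule.hom_eq_zero_of_isSimpleModule [IsNoetherian R X] [IsArtinian R X]
    [Module.Projective R X] (hX : IsIndecomposableModule R X) {S : Type u} [AddCommGroup S]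
    [Module R S] [IsSimpleModule R S] (hS : IsEmpty (S ≃ₗ[R] (X ⧸ Module.jacobson R X)))
    (h : X →ₗ[R] S) : h = 0 := by
  rcases LinearMap.surjective_or_eq_zero h with hs | h0
  · have hk := hX.eq_jacobson (LinearMap.isCoatom_ker_of_surjective hs)
    exact (hS.false ((Submodule.quotEquivOfEq _ _ hk).symm.trans
      (h.quotKerEquivOfSurjective hs)).symm).elim
  · exact h0

/-- A restricted `B`-module is perpendicular, so `X → X/Rad X ≅ S` would have to be zero. -/
theorem IsUniversalLocalization.isSimpleModule_restrictScalars [Module.Projective R X]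
    (hα : Function.Injective α) (hαπ : Function.Exact α π) (hπ : Function.Surjective π)
    (hl : IsUniversalLocalization l α) (S : ModuleCat.{u} B) (hS : IsSimpleModule B S) :
    IsSimpleModule R ((ModuleCat.restrictScalars l).obj S) ∧
      IsEmpty ((ModuleCat.restrictScalars l).obj S ≃ₗ[R] (X ⧸ Module.jacobson R X)) := by
  refine ⟨(isSimpleModule_restrictScalars_iff
    (hl.surjective_of_projective hα hαπ hπ) S).2 hS, ⟨fun e => ?_⟩⟩
  have hperp : IsPerpendicular (RingHom.id R) α ((ModuleCat.restrictScalars l).obj S) :=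
    (hl.1.isPerpendicular (Y := S)).of_addEquiv (AddEquiv.refl S) fun _ _ => rfl
  have h0 := hperp.hom_eq_zero hαπ hπ (e.symm.toLinearMap ∘ₗ Submodule.mkQ _)
  have := IsSimpleModule.nontrivial B S
  obtain ⟨s, hs⟩ := exists_ne (0 : S)
  obtain ⟨x, hx⟩ := Submodule.mkQ_surjective _ (e s)
  refine hs ?_
  have := LinearMap.congr_fun h0 x
  simp only [LinearMap.comp_apply, hx, LinearMap.zero_apply] at this
  exact e.map_eq_zero_iff.1 (by simpa using this)

theorem IsUniversalLocalization.exists_isSimpleModule [Module.Projective R X]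
    (hα : Function.Injective α) (hαπ : Function.Exact α π) (hπ : Function.Surjective π)
    [IsNoetherian R X] [IsArtinian R X] (hX : IsIndecomposableModule R X)
    (hl : IsUniversalLocalization l α) (S : ModuleCat.{u} R) (hS : IsSimpleModule R S)
    (hSX : IsEmpty (S ≃ₗ[R] (X ⧸ Module.jacobson R X))) :
    ∃ S' : ModuleCat.{u} B, IsSimpleModule B S' ∧
      Nonempty ((ModuleCat.restrictScalars l).obj S' ≅ S) := by
  obtain ⟨φ, hφ⟩ := hl.exists_action hα hαπ hπ (Y := S)
    fun h => hX.hom_eq_zero_of_isSimpleModule hSX h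
  let : Module B S := Module.compHom S φ
  let e : (ModuleCat.restrictScalars l).obj (ModuleCat.of B S) ≃ₗ[R] S :=
    { AddEquiv.refl S with map_smul' := fun r y => hφ r y }
  refine ⟨ModuleCat.of B S, ?_, ⟨e.toModuleIso⟩⟩
  rw [← isSimpleModule_restrictScalars_iff (hl.surjective_of_projective hα hαπ hπ)]
  exact e.isSimpleModule_iff.2 hS

theorem nonempty_iso_of_restrictScalars (hl : Function.Surjective l) (S S' : ModuleCat.{u} B)
    (h : Nonempty ((ModuleCat.restrictScalars l).obj S ≅ (ModuleCat.restrictScalars l).obj S')) :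
    Nonempty (S ≅ S') := by
  obtain ⟨i⟩ := h
  let e := i.toLinearEquiv
  let e' : S ≃ₗ[B] S' :=
    { e.toAddEquiv with
      map_smul' := fun b x => by
        obtain ⟨r, rfl⟩ := hl b
        exact e.map_smul r x }
  exact ⟨e'.toModuleIso⟩

end Simple

/-! ### Long exact sequences and the universal extension -/

section Ext

variable {C : Type*} [Category* C] [Abelian C] [HasExt C]

theorem exists_extension_of_subsingleton_ext {S : ShortComplex C} (hS : S.ShortExact) {Y : C}
    [Subsingleton (Ext S.X₃ Y 1)] (g : S.X₁ ⟶ Y) : ∃ h : S.X₂ ⟶ Y, S.f ≫ h = g := by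
  obtain ⟨x, hx⟩ := Ext.contravariant_sequence_exact₁ hS Y (Ext.mk₀ g) (add_zero 1)
    (Subsingleton.elim _ _)
  obtain ⟨h, rfl⟩ := (Ext.mk₀_bijective _ _).2 x
  exact ⟨h, (Ext.mk₀_bijective _ _).1 (by simpa using hx)⟩

theorem exists_extClass_comp_eq {S : ShortComplex C} (hS : S.ShortExact) [Projective S.X₂]
    {Y : C} (x : Ext S.X₃ Y 1) :
    ∃ g : S.X₁ ⟶ Y, hS.extClass.comp (Ext.mk₀ g) (add_zero 1) = x := by
  obtain ⟨y, hy⟩ := Ext.contravariant_sequence_exact₃ hS Y x (Ext.eq_zero_of_projective _)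
    (add_zero 1)
  obtain ⟨g, rfl⟩ := (Ext.mk₀_bijective _ _).2 y
  exact ⟨g, hy⟩

theorem subsingleton_ext_of_exists_extension {S : ShortComplex C} (hS : S.ShortExact)
    [Projective S.X₂] {Y : C} (h : ∀ g : S.X₁ ⟶ Y, ∃ k : S.X₂ ⟶ Y, S.f ≫ k = g) :
    Subsingleton (Ext S.X₃ Y 1) := by
  refine subsingleton_of_forall_eq 0 fun x => ?_
  obtain ⟨g, rfl⟩ := exists_extClass_comp_eq hS x
  obtain ⟨k, rfl⟩ := h g
  rw [← Ext.mk₀_comp_mk₀, hS.extClass_comp_assoc]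

theorem subsingleton_ext_of_shortExact {S : ShortComplex C} (hS : S.ShortExact) {Y : C}
    (h₁ : Subsingleton (Ext S.X₁ Y 1)) (h₃ : Subsingleton (Ext S.X₃ Y 1)) :
    Subsingleton (Ext S.X₂ Y 1) := by
  refine subsingleton_of_forall_eq 0 fun x => ?_
  obtain ⟨y, rfl⟩ := Ext.contravariant_sequence_exact₂ hS Y x (Subsingleton.elim _ _)
  rw [Subsingleton.elim y 0, Ext.comp_zero]

end Ext

section ModuleExt

variable {R : Type u} [Ring R]

/-- The coordinate projections of `Xⁿ`. -/
abbrev powProj (X : ModuleCat.{u} R) (n : ℕ) (i : Fin n) :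
    ModuleCat.of R (Fin n → X) ⟶ X := ModuleCat.ofHom (LinearMap.proj i)

/-- The coordinate injections of `Xⁿ`. -/
abbrev powSingle (X : ModuleCat.{u} R) (n : ℕ) (i : Fin n) :
    X ⟶ ModuleCat.of R (Fin n → X) := ModuleCat.ofHom (LinearMap.single R (fun _ => X) i)

theorem sum_powProj_comp_powSingle (X : ModuleCat.{u} R) (n : ℕ) :
    ∑ i, powProj X n i ≫ powSingle X n i = 𝟙 (ModuleCat.of R (Fin n → X)) := by
  apply ModuleCat.hom_ext
  rw [ModuleCat.hom_sum]
  refine LinearMap.ext fun x => ?_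
  simpa using LinearMap.sum_single_apply (fun _ : Fin n => X) x

theorem subsingleton_ext_pow_left {X Y : ModuleCat.{u} R} (n : ℕ)
    (h : Subsingleton (Ext X Y 1)) : Subsingleton (Ext (ModuleCat.of R (Fin n → X)) Y 1) := by
  refine subsingleton_of_forall_eq 0 fun x => ?_
  rw [← Ext.mk₀_id_comp x, ← sum_powProj_comp_powSingle, Ext.mk₀_sum, Ext.sum_comp]
  refine Finset.sum_eq_zero fun i _ => ?_
  rw [← Ext.mk₀_comp_mk₀_assoc, Subsingleton.elim (Ext.comp _ x _) 0, Ext.comp_zero]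

theorem subsingleton_ext_pow_right {X Y : ModuleCat.{u} R} (n : ℕ)
    (h : Subsingleton (Ext Y X 1)) : Subsingleton (Ext Y (ModuleCat.of R (Fin n → X)) 1) := by
  refine subsingleton_of_forall_eq 0 fun x => ?_
  rw [← Ext.comp_mk₀_id x, ← sum_powProj_comp_powSingle, Ext.mk₀_sum, Ext.comp_sum]
  refine Finset.sum_eq_zero fun i _ => ?_
  rw [← Ext.mk₀_comp_mk₀, ← Ext.comp_assoc_of_third_deg_zero,
    Subsingleton.elim (x.comp _ _) 0, Ext.zero_comp]

/-- Every element of `Ext¹ (Z, Y)` is the class of an extension. -/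
theorem exists_extClass_eq {Z Y : ModuleCat.{u} R} (x : Ext Z Y 1) :
    ∃ (M : ModuleCat.{u} R) (i : Y ⟶ M) (p : M ⟶ Z) (w : i ≫ p = 0)
      (hE : (ShortComplex.mk i p w).ShortExact), hE.extClass = x := by
  let S := Z.projectiveShortComplex
  have hS : S.ShortExact := Z.shortExact_projectiveShortComplex
  have : Projective S.X₂ := ModuleCat.projective_of_categoryTheory_projective _
  obtain ⟨g, rfl⟩ := exists_extClass_comp_eq hS x
  have hSfg : Function.Exact S.f.hom S.g.hom :=
    (ShortComplex.ShortExact.moduleCat_exact_iff_function_exact _).1 hS.exact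
  -- The extension is the pushout of a projective presentation of `Z` along `g`.
  let N : Submodule R (Y × S.X₂) := LinearMap.range (g.hom.prod (-S.f.hom))
  let i : Y →ₗ[R] (Y × S.X₂) ⧸ N := N.mkQ ∘ₗ LinearMap.inl R _ _
  let p : ((Y × S.X₂) ⧸ N) →ₗ[R] S.X₃ := N.liftQ (S.g.hom ∘ₗ LinearMap.snd R _ _) <| by
    rintro _ ⟨k, rfl⟩
    simp [hSfg.apply_apply_eq_zero]
  have hip : ∀ y, p (i y) = 0 := fun y => by simp [i, p]
  have hE : (ShortComplex.mk (ModuleCat.ofHom i) (ModuleCat.ofHom p)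
      (by ext y; exact hip y)).ShortExact := by
    refine ModuleCat.shortComplex_shortExact _ (fun m => ⟨?_, ?_⟩) ?_ ?_
    · obtain ⟨⟨y, v⟩, rfl⟩ := N.mkQ_surjective m
      intro hm
      obtain ⟨k, rfl⟩ := (hSfg v).1 hm
      refine ⟨y + g.hom k, (Submodule.Quotient.eq N).2 ⟨k, ?_⟩⟩
      simp
    · rintro ⟨y, rfl⟩
      exact hip y
    · refine (injective_iff_map_eq_zero i).2 fun y hy => ?_
      obtain ⟨k, hk⟩ := (Submodule.Quotient.mk_eq_zero N).1 hy
      have h1 : g.hom k = y := congrArg Prod.fst hk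
      have h2 : -S.f.hom k = 0 := congrArg Prod.snd hk
      have h3 : k = 0 := hS.moduleCat_injective_f (by simpa using h2)
      rw [← h1, h3, map_zero]
    · intro z
      obtain ⟨v, hv⟩ := hS.moduleCat_surjective_g z
      exact ⟨N.mkQ (0, v), hv⟩
  let φ : S ⟶ ShortComplex.mk (ModuleCat.ofHom i) (ModuleCat.ofHom p)
      (by ext y; exact hip y) :=
    { τ₁ := g
      τ₂ := ModuleCat.ofHom (N.mkQ ∘ₗ LinearMap.inr R _ _)
      τ₃ := 𝟙 Z
      comm₁₂ := by
        ext k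
        exact (Submodule.Quotient.eq N).2 ⟨k, by simp; exact ⟨rfl, rfl⟩⟩
      comm₂₃ := by
        ext v
        rfl }
  refine ⟨_, _, _, _, hE, ?_⟩
  rw [hS.extClass_naturality hE φ]
  exact (Ext.mk₀_id_comp _).symm

/-- Over an artin algebra, `Ext¹ (X, R)` is finitely generated over `End X`. -/
theorem exists_generatesExtOverEnd (hR : IsArtinAlgebra R) {S : ShortComplex (ModuleCat.{u} R)}
    (hS : S.ShortExact) [Projective S.X₂] [Module.Finite R S.X₁] :
    ∃ (n : ℕ) (e : Fin n → Ext S.X₃ (ModuleCat.of R R) 1),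
      GeneratesExtOverEnd S.X₃ (ModuleCat.of R R) e := by
  obtain ⟨k, _, _, _, _⟩ := hR
  -- `Hom(P, R)` embeds in `Rⁿ` by evaluation at generators, and it surjects onto `Ext¹(X, R)`.
  have hfin : Module.Finite k (S.X₁ →ₗ[R] R) := by
    obtain ⟨n, p, hp⟩ := Module.Finite.exists_fin' R S.X₁
    let ev : (S.X₁ →ₗ[R] R) →ₗ[k] (Fin n → R) :=
      { toFun := fun g j => g (p (Pi.single j 1))
        map_add' := fun _ _ => rfl
        map_smul' := fun _ _ => rfl }
    refine Module.Finite.of_injective ev fun g g' h => ?_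
    have : g ∘ₗ p = g' ∘ₗ p := LinearMap.pi_ext' fun j => LinearMap.ext_ring (congrFun h j)
    ext x
    obtain ⟨v, rfl⟩ := hp x
    exact LinearMap.congr_fun this v
  obtain ⟨n, g, hg⟩ := Module.Finite.exists_fin (R := k) (M := S.X₁ →ₗ[R] R)
  let act (a : k) (M : ModuleCat.{u} R) : M ⟶ M := ModuleCat.ofHom
    { toFun := fun x => algebraMap k R a • x
      map_add' := fun x y => smul_add _ x y
      map_smul' := fun r x => by
        rw [smul_smul, Algebra.commutes, RingHom.id_apply, smul_smul] }
  -- Scalars act on the whole sequence, so naturality of its class trades a scalar on the kernel for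
  -- an endomorphism of `X`.
  let φ (a : k) : S ⟶ S :=
    { τ₁ := act a _
      τ₂ := act a _
      τ₃ := act a _
      comm₁₂ := by ext x; exact S.f.hom.map_smul _ x
      comm₂₃ := by ext x; exact S.g.hom.map_smul _ x }
  refine ⟨n, fun j => hS.extClass.comp (Ext.mk₀ (ModuleCat.ofHom (g j))) (add_zero 1),
    fun x => ?_⟩
  obtain ⟨h, rfl⟩ := exists_extClass_comp_eq hS x
  have hmem : h.hom ∈ Submodule.span k (Set.range g) := by rw [hg]; trivial
  obtain ⟨a, ha⟩ := (Submodule.mem_span_range_iff_exists_fun k).1 hmem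
  refine ⟨fun j => act (a j) _, ?_⟩
  have hsum : h = ∑ j, act (a j) S.X₁ ≫ ModuleCat.ofHom (g j) := by
    apply ModuleCat.hom_ext
    rw [ModuleCat.hom_sum, ← ha]
    refine Finset.sum_congr rfl fun j _ => LinearMap.ext fun x => ?_
    exact (Algebra.smul_def _ _).trans ((g j).map_smul _ x).symm
  rw [hsum, Ext.mk₀_sum, Ext.comp_sum]
  refine Finset.sum_congr rfl fun j _ => ?_
  rw [← Ext.mk₀_comp_mk₀, ← Ext.comp_assoc_of_third_deg_zero]
  have := hS.extClass_naturality hS (φ (a j))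
  change hS.extClass.comp (Ext.mk₀ (act (a j) S.X₁)) _ = _ at this
  rw [this, Ext.comp_assoc_of_third_deg_zero]

/-- If `End X` is a division ring, then a minimal generating family of `Ext¹ (X, Y)` over `End X`
is linearly independent. -/
theorem GeneratesExtOverEnd.eq_zero_of_isLeast {X Y : ModuleCat.{u} R}
    (hX : ∀ f : X ⟶ X, f ≠ 0 → IsIso f) {c : ℕ}
    (hc : IsLeast {n : ℕ | ∃ e : Fin n → Ext X Y 1, GeneratesExtOverEnd X Y e} c)
    {e : Fin c → Ext X Y 1} (he : GeneratesExtOverEnd X Y e) {f : Fin c → (X ⟶ X)}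
    (hf : ∑ i, (Ext.mk₀ (f i)).comp (e i) (zero_add 1) = 0) (j : Fin c) : f j = 0 := by
  by_contra hj
  have := hX _ hj
  obtain _ | m := c
  · exact j.elim0
  refine absurd (hc.2 ⟨fun i => e (j.succAbove i), fun x => ?_⟩) (Nat.not_succ_le_self m)
  obtain ⟨g, rfl⟩ := he x
  -- Subtract the multiple of the relation that cancels the coefficient of `e j`; the other `m`
  -- elements then generate, against minimality.
  refine ⟨fun i => g (j.succAbove i) - (g j ≫ inv (f j)) ≫ f (j.succAbove i), ?_⟩
  have hsub : ∑ i, (Ext.mk₀ (g i)).comp (e i) (zero_add 1) =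
      ∑ i, (Ext.mk₀ (g i - (g j ≫ inv (f j)) ≫ f i)).comp (e i) (zero_add 1) := by
    rw [← sub_eq_zero, ← Finset.sum_sub_distrib,
      ← Ext.comp_zero (Ext.mk₀ (g j ≫ inv (f j))) Y 1 1 (zero_add 1), ← hf, Ext.comp_sum]
    refine Finset.sum_congr rfl fun i _ => ?_
    rw [Ext.mk₀_comp_mk₀_assoc, sub_eq_add_neg, ← Ext.neg_comp, ← Ext.add_comp, ← Ext.mk₀_neg,
      ← Ext.mk₀_add]
    simp
  rw [hsub, Fin.sum_univ_succAbove _ j]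
  simp

/-- The universal extension of copies of `X` by `R` is right perpendicular to `X`. -/
theorem exists_universal_extension {X Y : ModuleCat.{u} R}
    (hX : ∀ f : X ⟶ X, f ≠ 0 → IsIso f) (hXX : Subsingleton (Ext X X 1))
    (hXY : ∀ f : X ⟶ Y, f = 0)
    (hgen : ∃ (n : ℕ) (e : Fin n → Ext X Y 1), GeneratesExtOverEnd X Y e) :
    ∃ c, IsLeast {n : ℕ | ∃ e : Fin n → Ext X Y 1, GeneratesExtOverEnd X Y e} c ∧
      ∃ (M : ModuleCat.{u} R) (i : Y ⟶ M) (p : M ⟶ ModuleCat.of R (Fin c → X)) (w : i ≫ p = 0),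
        (ShortComplex.mk i p w).ShortExact ∧ (∀ f : X ⟶ M, f = 0) ∧
          Subsingleton (Ext X M 1) := by
  classical
  let c := Nat.find hgen
  have hc : IsLeast {n : ℕ | ∃ e : Fin n → Ext X Y 1, GeneratesExtOverEnd X Y e} c :=
    ⟨Nat.find_spec hgen, fun n hn => Nat.find_min' hgen hn⟩
  obtain ⟨e, he⟩ := hc.1
  obtain ⟨M, i, p, w, hE, hcl⟩ := exists_extClass_eq
    (∑ j, (Ext.mk₀ (powProj X c j)).comp (e j) (zero_add 1))
  have hpull : ∀ f : X ⟶ ModuleCat.of R (Fin c → X),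
      (Ext.mk₀ f).comp hE.extClass (zero_add 1) =
        ∑ j, (Ext.mk₀ (f ≫ powProj X c j)).comp (e j) (zero_add 1) := by
    intro f
    rw [hcl, Ext.comp_sum]
    exact Finset.sum_congr rfl fun j _ => by rw [Ext.mk₀_comp_mk₀_assoc]
  refine ⟨c, hc, M, i, p, w, hE, fun f => ?_, ?_⟩
  -- The extension pulled back along `f ≫ p` splits, giving a relation among the `e j`; independence
  -- makes every coordinate zero. So `f` factors through `Y`.
  · have h0 : f ≫ p = 0 := by
      have := hpull (f ≫ p)
      rw [← Ext.mk₀_comp_mk₀_assoc, hE.comp_extClass, Ext.comp_zero] at this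
      ext x j
      exact LinearMap.congr_fun (congrArg ModuleCat.Hom.hom
        (he.eq_zero_of_isLeast hX hc this.symm j)) x
    obtain ⟨y, hy⟩ := Ext.covariant_sequence_exact₂ X hE (Ext.mk₀ f) (by simp [h0])
    obtain ⟨g, rfl⟩ := (Ext.mk₀_bijective _ _).2 y
    rw [hXY g, Ext.mk₀_zero, Ext.zero_comp] at hy
    exact (Ext.mk₀_eq_zero_iff f).1 hy.symm
  · refine subsingleton_of_forall_eq 0 fun x => ?_
    have := subsingleton_ext_pow_right c hXX
    -- Every class comes from `Ext¹(X, Y)`, where it is a pullback of the extension; pushing that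
    -- out along `i` gives zero.
    obtain ⟨y, rfl⟩ := Ext.covariant_sequence_exact₂ X hE x (Subsingleton.elim _ _)
    obtain ⟨g, rfl⟩ := he y
    let f : X ⟶ ModuleCat.of R (Fin c → X) := ModuleCat.ofHom (LinearMap.pi fun j => (g j).hom)
    have hf : ∀ j, f ≫ powProj X c j = g j := fun j => rfl
    have := hpull f
    simp only [hf] at this
    rw [← this, Ext.comp_assoc_of_third_deg_zero]
    exact (congrArg (fun z => (Ext.mk₀ f).comp z (zero_add 1)) hE.extClass_comp).trans
      (Ext.comp_zero _ _ _ _ _)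

end ModuleExt

/-! ### Computing `Ext¹(X, -)` from the resolution -/

section Resolution

variable {R : Type u} [Ring R] {P Q : Type u} [AddCommGroup P] [Module R P]
  [AddCommGroup Q] [Module R Q] {X : ModuleCat.{u} R} {α : P →ₗ[R] Q} {π : Q →ₗ[R] X}

theorem shortExact_ofHom (hα : Function.Injective α) (hαπ : Function.Exact α π)
    (hπ : Function.Surjective π) :
    (ShortComplex.mk (ModuleCat.ofHom α) (ModuleCat.ofHom (Y := X) π)
      (by ext p; exact hαπ.apply_apply_eq_zero p)).ShortExact :=
  ModuleCat.shortComplex_shortExact _ hαπ hα hπ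

theorem subsingleton_ext_iff_exists_extension [Module.Projective R Q]
    (hα : Function.Injective α) (hαπ : Function.Exact α π) (hπ : Function.Surjective π)
    {Y : ModuleCat.{u} R} :
    Subsingleton (Ext X Y 1) ↔ ∀ g : P →ₗ[R] Y, ∃ h : Q →ₗ[R] Y, h ∘ₗ α = g := by
  have hS := shortExact_ofHom hα hαπ hπ
  refine ⟨fun (_ : Subsingleton (Ext X Y 1)) g => ?_, fun h => ?_⟩
  · obtain ⟨k, hk⟩ := exists_extension_of_subsingleton_ext hS (ModuleCat.ofHom (Y := Y) g)
    exact ⟨k.hom, congrArg ModuleCat.Hom.hom hk⟩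
  · have : Projective (ModuleCat.of R Q) := ModuleCat.projective_of_categoryTheory_projective _
    refine subsingleton_ext_of_exists_extension hS fun g => ?_
    obtain ⟨k, hk⟩ := h g.hom
    exact ⟨ModuleCat.ofHom k, ModuleCat.hom_ext hk⟩

theorem IsPerpendicular.subsingleton_ext [Module.Projective R Q]
    (hα : Function.Injective α) (hαπ : Function.Exact α π) (hπ : Function.Surjective π)
    {Y : ModuleCat.{u} R} (hY : IsPerpendicular (RingHom.id R) α Y) :
    Subsingleton (Ext X Y 1) :=
  (subsingleton_ext_iff_exists_extension hα hαπ hπ).2 fun g =>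
    (hY g).exists.imp fun _ hh => LinearMap.ext hh

theorem isPerpendicular_of_subsingleton_ext [Module.Projective R Q]
    (hα : Function.Injective α) (hαπ : Function.Exact α π) (hπ : Function.Surjective π)
    {Y : ModuleCat.{u} R} (hXY : ∀ f : X ⟶ Y, f = 0) (hext : Subsingleton (Ext X Y 1)) :
    IsPerpendicular (RingHom.id R) α Y := by
  intro g
  obtain ⟨h, rfl⟩ := (subsingleton_ext_iff_exists_extension hα hαπ hπ).1 hext g
  refine ⟨h, fun p => rfl, fun h' hh' => sub_eq_zero.1 ?_⟩
  have hS := shortExact_ofHom hα hαπ hπ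
  have := hS.epi_g
  have h0 : ModuleCat.ofHom α ≫ ModuleCat.ofHom (Y := Y) (h' - h) = 0 := by
    ext p
    exact sub_eq_zero.2 (hh' p)
  have hd := hS.exact.g_desc _ h0
  -- Two extensions of `g` differ by a map that factors through `X`.
  rw [hXY (hS.exact.desc _ h0), Limits.comp_zero] at hd
  exact congrArg ModuleCat.Hom.hom hd.symm

/-- `Ext¹ (X, -)` commutes with direct sums, to the extent that it vanishes on them. -/
theorem subsingleton_ext_finsupp [Module.Projective R Q] [Module.Finite R P]
    (hα : Function.Injective α) (hαπ : Function.Exact α π) (hπ : Function.Surjective π)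
    {Y : ModuleCat.{u} R} (hY : Subsingleton (Ext X Y 1)) (I : Type u) :
    Subsingleton (Ext X (ModuleCat.of R (I →₀ Y)) 1) := by
  classical
  rw [subsingleton_ext_iff_exists_extension hα hαπ hπ] at hY ⊢
  intro g
  change P →ₗ[R] (I →₀ Y) at g
  choose h hh using fun i : I => hY (Finsupp.lapply i ∘ₗ g)
  obtain ⟨t, ht⟩ := Module.Finite.fg_top (R := R) (M := P)
  -- As `P` is finitely generated, `g` meets only finitely many coordinates.
  let s := t.sup fun p => (g p).support
  have hs : ∀ p, (g p).support ⊆ s := by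
    intro p
    have hle : Submodule.span R (t : Set P) ≤ (Finsupp.supported Y R (s : Set I)).comap g :=
      Submodule.span_le.2 fun p hp => Finset.coe_subset.2
        (Finset.le_sup (f := fun p => (g p).support) hp)
    exact Finset.coe_subset.1 (hle (ht ▸ Submodule.mem_top))
  refine ⟨∑ i ∈ s, Finsupp.lsingle i ∘ₗ h i, LinearMap.ext fun p => ?_⟩
  have hp : ∀ i, h i (α p) = g p i := fun i => LinearMap.congr_fun (hh i) p
  rw [LinearMap.comp_apply, LinearMap.sum_apply]
  simp only [LinearMap.comp_apply, hp, Finsupp.lsingle_apply]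
  rw [← Finsupp.sum_of_support_subset (g p) (hs p) (fun i y => Finsupp.single i y) (by simp)]
  exact Finsupp.sum_single (g p)

theorem subsingleton_ext_prod [Module.Projective R Q]
    (hα : Function.Injective α) (hαπ : Function.Exact α π) (hπ : Function.Surjective π)
    {Y Z : ModuleCat.{u} R} (hY : Subsingleton (Ext X Y 1)) (hZ : Subsingleton (Ext X Z 1)) :
    Subsingleton (Ext X (ModuleCat.of R (Y × Z)) 1) := by
  rw [subsingleton_ext_iff_exists_extension hα hαπ hπ] at hY hZ ⊢
  intro g
  change P →ₗ[R] Y × Z at g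
  obtain ⟨h₁, hh₁⟩ := hY (LinearMap.fst R _ _ ∘ₗ g)
  obtain ⟨h₂, hh₂⟩ := hZ (LinearMap.snd R _ _ ∘ₗ g)
  exact ⟨h₁.prod h₂, LinearMap.ext fun p => Prod.ext (LinearMap.congr_fun hh₁ p)
    (LinearMap.congr_fun hh₂ p)⟩

/-- If `0 → R → M → Xᶜ → 0` is exact and `M` is right perpendicular to `X`, then `M` is the
reflection of `R`. -/
theorem isReflection_of_shortExact [Module.Projective R Q]
    (hα : Function.Injective α) (hαπ : Function.Exact α π) (hπ : Function.Surjective π)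
    {M : ModuleCat.{u} R} {c : ℕ} {i : ModuleCat.of R R ⟶ M}
    {p : M ⟶ ModuleCat.of R (Fin c → X)} {w : i ≫ p = 0}
    (hE : (ShortComplex.mk i p w).ShortExact) (hM : IsPerpendicular (RingHom.id R) α M) :
    IsReflection α (i.hom (1 : R)) where
  isPerpendicular := hM
  exists_lift Y _ _ hY y := by
    have hext : Subsingleton (Ext X (ModuleCat.of R Y) 1) :=
      IsPerpendicular.subsingleton_ext hα hαπ hπ hY
    have : Subsingleton (Ext (ShortComplex.mk i p w).X₃ (ModuleCat.of R Y) 1) :=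
      subsingleton_ext_pow_left c hext
    obtain ⟨h, hh⟩ := exists_extension_of_subsingleton_ext hE
      (ModuleCat.ofHom (LinearMap.toSpanSingleton R Y y))
    refine ⟨h.hom, ?_⟩
    have := LinearMap.congr_fun (congrArg ModuleCat.Hom.hom hh) (1 : R)
    exact this.trans (one_smul R y)
  hom_ext Y _ _ hY h₁ h₂ h := by
    refine sub_eq_zero.1 ?_
    have := hE.epi_g
    have h0 : i ≫ ModuleCat.ofHom (h₁ - h₂) = 0 := by
      apply ModuleCat.hom_ext
      exact LinearMap.ext_ring (sub_eq_zero.2 h)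
    have hd := hE.exact.g_desc _ h0
    -- The difference factors through `X^c`, and `Hom(X, Y) = 0`.
    have hz : hE.exact.desc _ h0 = 0 := by
      apply ModuleCat.hom_ext
      exact LinearMap.pi_ext' fun j => hY.hom_eq_zero hαπ hπ _
    rw [hz, Limits.comp_zero] at hd
    exact congrArg ModuleCat.Hom.hom hd.symm

end Resolution

/-! ### Semihereditary rings and the Happel–Ringel lemma -/

section Hereditary

variable {R : Type u} [Ring R]

theorem IsArtinAlgebra.isArtinianRing (hR : IsArtinAlgebra R) : IsArtinianRing R := by
  obtain ⟨k, _, _, _, _⟩ := hR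
  exact isArtinian_of_tower k inferInstance

theorem IsIndecomposableModule.injective_or_eq_zero_of_comp_eq_id {X : Type u} [AddCommGroup X]
    [Module R X] (hX : IsIndecomposableModule R X) {Z : Type u} [AddCommGroup Z] [Module R Z]
    (r : X →ₗ[R] Z) (s : Z →ₗ[R] X) (hrs : ∀ z, r (s z) = z) : Function.Injective r ∨ r = 0 := by
  have hc : IsCompl (LinearMap.ker r) (LinearMap.range s) := by
    constructor
    · rw [Submodule.disjoint_def]
      rintro _ hx ⟨z, rfl⟩
      rw [LinearMap.mem_ker, hrs] at hx
      rw [hx, map_zero]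
    · rw [codisjoint_iff, eq_top_iff]
      rintro x -
      exact Submodule.mem_sup.2 ⟨x - s (r x), by simp [hrs], s (r x), ⟨r x, rfl⟩, by simp⟩
  refine (hX.2 _ _ hc).imp LinearMap.ker_eq_bot.1 fun h => ?_
  ext x
  rw [← hrs (r x), LinearMap.range_eq_bot.1 h]
  simp

/-- Over a semihereditary ring, a finitely generated indecomposable module which is not projective
has no nonzero homomorphism to a projective module. -/
theorem IsSemihereditaryRing.hom_eq_zero (hsemi : IsSemihereditaryRing R) {X : Type u}
    [AddCommGroup X] [Module R X] [Module.Finite R X] (hX : IsIndecomposableModule R X)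
    (hnp : ¬ Module.Projective R X) {F : Type u} [AddCommGroup F] [Module R F]
    [hF : Module.Projective R F] (h : X →ₗ[R] F) : h = 0 := by
  -- The image is projective, hence splits off `X`; by indecomposability it is zero or all of `X`.
  have hproj : Module.Projective R (LinearMap.range h) :=
    hsemi F hF _ (Module.Finite.iff_fg.1 inferInstance)
  obtain ⟨s, hs⟩ := Module.projective_lifting_property h.rangeRestrict LinearMap.id
    h.surjective_rangeRestrict
  rcases hX.injective_or_eq_zero_of_comp_eq_id h.rangeRestrict s
    (LinearMap.congr_fun hs) with hi | h0
  · exact absurd (Module.Projective.of_equiv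
      (LinearEquiv.ofBijective _ ⟨hi, h.surjective_rangeRestrict⟩).symm) hnp
  · ext x
    exact congrArg Subtype.val (LinearMap.congr_fun h0 x)

/-- The Happel–Ringel lemma: over a semihereditary artinian ring, nonzero endomorphisms of an
indecomposable finitely generated module without self-extensions are bijective. -/
theorem IsSemihereditaryRing.bijective_of_ne_zero [IsArtinianRing R]
    (hsemi : IsSemihereditaryRing R) {X : ModuleCat.{u} R} [Module.Finite R X]
    (hX : IsIndecomposableModule R X) (hXX : Subsingleton (Ext X X 1)) {Q : Type u}
    [AddCommGroup Q] [Module R Q] [hQ : Module.Projective R Q] [Module.Finite R Q]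
    {π : Q →ₗ[R] X} (hπ : Function.Surjective π) {f : X →ₗ[R] X} (hf : f ≠ 0) :
    Function.Bijective f := by
  let I := LinearMap.range f
  let q : X →ₗ[R] I := f.rangeRestrict
  let N : Submodule R Q := I.comap π
  let h : N →ₗ[R] I := (π ∘ₗ N.subtype).codRestrict I fun n => n.2
  have hN : Module.Projective R N := hsemi Q hQ N (IsNoetherian.noetherian N)
  obtain ⟨h', hh'⟩ := Module.projective_lifting_property q h f.surjective_rangeRestrict
  have hh'' : ∀ n : N, f (h' n) = π n := fun n => congrArg Subtype.val (LinearMap.congr_fun hh' n)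
  let β : N →ₗ[R] Q × I := N.subtype.prod h
  let ρ : Q × I →ₗ[R] X := π ∘ₗ LinearMap.fst R _ _ - I.subtype ∘ₗ LinearMap.snd R _ _
  have hβ : Function.Injective β := fun n n' e => Subtype.ext (congrArg Prod.fst e)
  have hρ : Function.Surjective ρ := fun x => by
    obtain ⟨y, rfl⟩ := hπ x
    exact ⟨(y, 0), by simp [ρ]⟩
  have hβρ : Function.Exact β ρ := by
    rintro ⟨y, i⟩
    constructor
    · intro hy
      have hy' : π y = i := sub_eq_zero.1 hy
      exact ⟨⟨y, (congrArg (· ∈ I) hy').mpr i.2⟩, Prod.ext rfl (Subtype.ext hy')⟩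
    · rintro ⟨n, hn⟩
      rw [← hn]
      exact sub_self (π n)
  -- In `0 → N → Q ⊕ I → X → 0`, vanishing of `Ext¹(X, X)` extends the lift `h'` of `N → I` through
  -- `f`.
  obtain ⟨k, hk⟩ := exists_extension_of_subsingleton_ext (shortExact_ofHom hβ hβρ hρ)
    (Y := X) (ModuleCat.ofHom h')
  have hk' : ∀ n : N, k.hom ((n : Q), h n) = h' n := fun n =>
    LinearMap.congr_fun (congrArg ModuleCat.Hom.hom hk) n
  let a : Q →ₗ[R] X := k.hom ∘ₗ LinearMap.inl R Q I
  let θ : Module.End R X := (k.hom ∘ₗ LinearMap.inr R Q I) ∘ₗ q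
  have hθ : ∀ n : N, (1 - θ) (h' n) = a n := by
    intro n
    have e1 : θ (h' n) = k.hom ((0 : Q), h n) :=
      congrArg (fun i : I => k.hom ((0 : Q), i)) (LinearMap.congr_fun hh' n)
    have e2 : k.hom ((n : Q), h n) = a n + k.hom ((0 : Q), h n) := by
      change _ = k.hom ((n : Q), (0 : I)) + _
      rw [← map_add]
      simp
    rw [LinearMap.sub_apply, Module.End.one_apply, e1, ← hk', e2, add_sub_cancel_right]
  -- `θ` factors through `f`, so if it is bijective then `f` is injective. If it is nilpotent, `1 -
  -- θ` is invertible and `h'` extends to `v ∘ a` on `Q`; then `π - f ∘ v ∘ a` kills `N` and induces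
  -- a section of `X → X/I`, so `I` is `0` or `X`.
  rcases hX.bijective_or_isNilpotent θ with hb | hn
  · refine IsArtinian.bijective_of_injective_endomorphism f fun x y hxy => hb.1 ?_
    exact congrArg (k.hom ∘ₗ LinearMap.inr R Q I) (Subtype.ext hxy : q x = q y)
  · obtain ⟨u, hu⟩ := hn.isUnit_one_sub
    let v : Module.End R X := ↑u⁻¹
    have hv : ∀ n : N, h' n = v (a n) := by
      intro n
      rw [← hθ, ← hu, ← Module.End.mul_apply, Units.inv_mul, Module.End.one_apply]
    let φ : Q →ₗ[R] X := π - f ∘ₗ v ∘ₗ a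
    let r : Q →ₗ[R] X ⧸ I := I.mkQ ∘ₗ π
    have hr : Function.Surjective r := I.mkQ_surjective.comp hπ
    have hker : LinearMap.ker r ≤ LinearMap.ker φ := by
      intro y hy
      have hyI : y ∈ N := (Submodule.Quotient.mk_eq_zero I).1 hy
      change π y - f (v (a y)) = 0
      rw [← hv ⟨y, hyI⟩, hh'', sub_self]
    let t : X ⧸ I →ₗ[R] X := (LinearMap.ker r).liftQ φ hker ∘ₗ
      (r.quotKerEquivOfSurjective hr).symm.toLinearMap
    have ht : ∀ y, t (r y) = φ y := by
      intro y
      have : (r.quotKerEquivOfSurjective hr).symm (r y) = (LinearMap.ker r).mkQ y := by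
        rw [LinearEquiv.symm_apply_eq]
        rfl
      simp [t, this]
    have hsec : ∀ z, I.mkQ (t z) = z := by
      intro z
      obtain ⟨y, rfl⟩ := hr z
      rw [ht]
      refine (Submodule.Quotient.eq I).2 ?_
      simp [φ, I]
    rcases hX.injective_or_eq_zero_of_comp_eq_id I.mkQ t hsec with hi | h0
    · refine absurd (LinearMap.range_eq_bot.1 ?_) hf
      rw [← LinearMap.ker_eq_bot, Submodule.ker_mkQ] at hi
      exact hi
    · refine IsNoetherian.bijective_of_surjective_endomorphism f (LinearMap.range_eq_top.1 ?_)
      rw [← LinearMap.ker_eq_top, Submodule.ker_mkQ] at h0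
      exact h0

theorem IsSemihereditaryRing.hasProjectiveDimensionLE_one [IsArtinianRing R]
    (hsemi : IsSemihereditaryRing R) (M : ModuleCat.{u} R) [Module.Finite R M] :
    HasProjectiveDimensionLE M 1 := by
  obtain ⟨n, p, hp⟩ := Module.Finite.exists_fin' R M
  have hS := LinearMap.shortExact_shortComplexKer hp
  have : Module.Projective R (LinearMap.ker p) :=
    hsemi _ inferInstance _ (IsNoetherian.noetherian _)
  have h₁ : Projective (ModuleCat.of R (LinearMap.ker p)) :=
    ModuleCat.projective_of_categoryTheory_projective _
  have h₂ : Projective (ModuleCat.of R (Fin n → R)) :=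
    ModuleCat.projective_of_categoryTheory_projective _
  exact (hS.hasProjectiveDimensionLT_X₃_iff 0 h₂).2
    (inferInstanceAs (HasProjectiveDimensionLT (ModuleCat.of R (LinearMap.ker p)) 1))

end Hereditary

/-! ### The tilting module and the Bongartz sequence -/

section Tilting

variable {R : Type u} [Ring R]

theorem inAdd_prod_left (M X : ModuleCat.{u} R) : InAdd (ModuleCat.of R (M × X)) M :=
  ⟨PUnit, Finsupp.lsingle PUnit.unit ∘ₗ LinearMap.inl R M X,
    LinearMap.fst R M X ∘ₗ Finsupp.lapply PUnit.unit, by ext; simp⟩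

theorem inAdd_prod_pow_right (M X : ModuleCat.{u} R) (c : ℕ) :
    InAdd (ModuleCat.of R (M × X)) (ModuleCat.of R (Fin c → X)) := by
  refine ⟨ULift (Fin c), (Finsupp.linearEquivFunOnFinite R (M × X) (ULift (Fin c))).symm.toLinearMap
      ∘ₗ LinearMap.pi fun j => LinearMap.inr R M X ∘ₗ LinearMap.proj j.down,
    LinearMap.pi fun j => LinearMap.snd R M X ∘ₗ Finsupp.lapply (ULift.up j), ?_⟩
  refine LinearMap.ext fun x => ?_
  rfl

/-- The given sequence is the coresolution. `Ext¹(X, -)` vanishes on sums of copies of `M × X`;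
since `R` is projective, the sequence carries this over to `Ext¹(M, -)`. -/
theorem isTiltingModule_prod [IsArtinianRing R] (hsemi : IsSemihereditaryRing R)
    {P Q : Type u} [AddCommGroup P] [Module R P] [AddCommGroup Q] [Module R Q]
    [Module.Finite R P] [Module.Projective R Q]
    {X : ModuleCat.{u} R} [Module.Finite R X] {α : P →ₗ[R] Q} {π : Q →ₗ[R] X}
    (hα : Function.Injective α) (hαπ : Function.Exact α π) (hπ : Function.Surjective π)
    {M : ModuleCat.{u} R} {c : ℕ} {i : ModuleCat.of R R ⟶ M}
    {p : M ⟶ ModuleCat.of R (Fin c → X)} {w : i ≫ p = 0}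
    (hE : (ShortComplex.mk i p w).ShortExact)
    (hXX : Subsingleton (Ext X X 1)) (hXM : Subsingleton (Ext X M 1)) :
    IsTiltingModule (ModuleCat.of R (M × X)) := by
  have hex := (ShortComplex.ShortExact.moduleCat_exact_iff_function_exact _).1 hE.exact
  have hfin : Module.Finite R M := Module.Finite.of_exact (M := R) hex hE.moduleCat_surjective_g
  refine ⟨hsemi.hasProjectiveDimensionLE_one _, fun I => ?_,
    ⟨M, ModuleCat.of R (Fin c → X), i.hom, p.hom, inAdd_prod_left M X,
      inAdd_prod_pow_right M X c, hE.moduleCat_injective_f, hex, hE.moduleCat_surjective_g⟩⟩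
  have hX := subsingleton_ext_finsupp hα hαπ hπ (subsingleton_ext_prod hα hαπ hπ hXM hXX) I
  have hR : Projective (ModuleCat.of R R) := ModuleCat.projective_of_categoryTheory_projective _
  have hM := subsingleton_ext_of_shortExact hE
    (Ext.subsingleton_of_projective (ModuleCat.of R R) _ 0) (subsingleton_ext_pow_left c hX)
  have hs : (ShortComplex.mk (ModuleCat.ofHom (LinearMap.inl R M X))
      (ModuleCat.ofHom (LinearMap.snd R M X)) (by ext; rfl)).ShortExact :=
    ModuleCat.shortComplex_shortExact _ .inl_snd LinearMap.inl_injective LinearMap.snd_surjective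
  exact subsingleton_ext_of_shortExact hs hM hX

end Tilting

section Main

variable {R : Type u} [Ring R] {P Q : Type u} [AddCommGroup P] [Module R P]
  [AddCommGroup Q] [Module R Q] {X : ModuleCat.{u} R} {α : P →ₗ[R] Q} {π : Q →ₗ[R] X}

/-- The universal extension of a non-projective `X` by `R`: its middle term is the reflection. -/
theorem exists_bongartz_isReflection (hR : IsArtinAlgebra R) (hsemi : IsSemihereditaryRing R)
    [Module.Finite R X] (hXX : Subsingleton (Ext X X 1)) (hind : IsIndecomposableModule R X)
    [Module.Finite R P] [Module.Projective R Q] [Module.Finite R Q]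
    (hα : Function.Injective α) (hαπ : Function.Exact α π) (hπ : Function.Surjective π)
    (hnp : ¬ Module.Projective R X) :
    ∃ c, IsLeast {n : ℕ | ∃ e : Fin n → Ext X (ModuleCat.of R R) 1,
        GeneratesExtOverEnd X (ModuleCat.of R R) e} c ∧
      ∃ (M : ModuleCat.{u} R) (i : ModuleCat.of R R ⟶ M) (p : M ⟶ ModuleCat.of R (Fin c → X))
        (w : i ≫ p = 0), (ShortComplex.mk i p w).ShortExact ∧ Module.Finite R M ∧
          IsReflection α (i.hom (1 : R)) := by
  have := hR.isArtinianRing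
  have hend : ∀ f : X ⟶ X, f ≠ 0 → IsIso f := fun f hf =>
    (ConcreteCategory.isIso_iff_bijective f).2 (hsemi.bijective_of_ne_zero hind hXX hπ
      (f := f.hom) fun h => hf (ModuleCat.hom_ext h))
  have hXR : ∀ f : X ⟶ ModuleCat.of R R, f = 0 := fun f =>
    ModuleCat.hom_ext (hsemi.hom_eq_zero hind hnp f.hom)
  have hS := shortExact_ofHom hα hαπ hπ
  have hQ : Projective (ModuleCat.of R Q) := ModuleCat.projective_of_categoryTheory_projective _
  have hP : Module.Finite R (ModuleCat.of R P) := inferInstanceAs (Module.Finite R P)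
  obtain ⟨c, hc, M, i, p, w, hE, hXM, hextM⟩ :=
    exists_universal_extension hend hXX hXR (exists_generatesExtOverEnd hR hS)
  refine ⟨c, hc, M, i, p, w, hE, ?_, isReflection_of_shortExact hα hαπ hπ hE
    (isPerpendicular_of_subsingleton_ext hα hαπ hπ hXM hextM)⟩
  exact Module.Finite.of_exact (M := R)
    ((ShortComplex.ShortExact.moduleCat_exact_iff_function_exact _).1 hE.exact)
    hE.moduleCat_surjective_g

end Main

end

theorem mainTheorem11 (R : Type u) [Ring R] (hR : IsArtinAlgebra R)
    (hsemi : IsSemihereditaryRing R)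
    (X : ModuleCat.{u} R) (hfp : Module.FinitePresentation R X)
    (hexc : IsExceptionalModule X) (hind : IsIndecomposableModule R X)
    -- a resolution `0 → P → Q → X → 0` by finitely generated projective modules
    (P Q : Type u) [AddCommGroup P] [Module R P] [AddCommGroup Q] [Module R Q]
    (hP : Module.Projective R P) (hPfin : Module.Finite R P)
    (hQ : Module.Projective R Q) (hQfin : Module.Finite R Q)
    (α : P →ₗ[R] Q) (π : Q →ₗ[R] X)
    (hα : Function.Injective α) (hαπ : Function.Exact α π) (hπ : Function.Surjective π) :
    -- the universal localization of `R` at `X` exists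
    (∃ (B : Type u) (_ : Ring B) (l : R →+* B), IsUniversalLocalization l α) ∧
    ∀ (B : Type u) [Ring B] (l : R →+* B), IsUniversalLocalization l α →
      (Module.Projective R X →
        IsArtinAlgebra B ∧
        -- restriction along `l` identifies the simple `B`-modules, up to isomorphism, with the
        -- simple `R`-modules that are not isomorphic to `X / Rad X`
        (∀ S : ModuleCat.{u} B, IsSimpleModule B S →
          IsSimpleModule R ((ModuleCat.restrictScalars l).obj S) ∧
          IsEmpty ((ModuleCat.restrictScalars l).obj S ≃ₗ[R] (X ⧸ Module.jacobson R X))) ∧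
        (∀ S : ModuleCat.{u} R, IsSimpleModule R S →
          IsEmpty (S ≃ₗ[R] (X ⧸ Module.jacobson R X)) →
          ∃ S' : ModuleCat.{u} B, IsSimpleModule B S' ∧
            Nonempty ((ModuleCat.restrictScalars l).obj S' ≅ S)) ∧
        (∀ S S' : ModuleCat.{u} B, IsSimpleModule B S → IsSimpleModule B S' →
          Nonempty ((ModuleCat.restrictScalars l).obj S ≅ (ModuleCat.restrictScalars l).obj S') →
          Nonempty (S ≅ S'))) ∧
      (projectiveDimension X = 1 →
        IsArtinAlgebra B ∧
        IsTiltingModule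
          (ModuleCat.of R ((ModuleCat.restrictScalars l).obj (ModuleCat.of B B) × X)) ∧
        IsBongartzComplement X ((ModuleCat.restrictScalars l).obj (ModuleCat.of B B))) := by
  have hXX : Subsingleton (Ext X X 1) := hexc 1 one_ne_zero
  have hRart := hR.isArtinianRing
  have hXfin : Module.Finite R X := Module.Finite.of_surjective π hπ
  refine ⟨?_, fun B _ l hl => ⟨fun hX => ⟨?_, ?_, ?_, ?_⟩, fun hpd => ?_⟩⟩
  · by_cases hX : Module.Projective R X
    · exact ⟨_, _, _, (exists_isReflection_of_projective hα hαπ hπ).isUniversalLocalization⟩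
    · obtain ⟨_, _, _, _, _, _, _, _, hM⟩ :=
        exists_bongartz_isReflection hR hsemi hXX hind hα hαπ hπ hX
      exact ⟨_, _, _, hM.isUniversalLocalization⟩
  · exact (exists_isReflection_of_projective hα hαπ hπ).isArtinAlgebra hR hl
  · exact hl.isSimpleModule_restrictScalars hα hαπ hπ
  · exact hl.exists_isSimpleModule hα hαπ hπ hind
  · exact fun S S' _ _ => nonempty_iso_of_restrictScalars
      (hl.surjective_of_projective hα hαπ hπ) S S'
  · have hnp : ¬ Module.Projective R X := fun hX => by
      have : Projective X := ModuleCat.projective_of_categoryTheory_projective X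
      have hlt : projectiveDimension X < (1 : ℕ) := projectiveDimension_lt_iff.2 inferInstance
      exact absurd hpd (ne_of_lt (by simpa using hlt))
    obtain ⟨c, hc, M, i, p, w, hE, _, hM⟩ :=
      exists_bongartz_isReflection hR hsemi hXX hind hα hαπ hπ hnp
    obtain ⟨e, he, -⟩ := hM.exists_addEquiv hl
    let BR := (ModuleCat.restrictScalars l).obj (ModuleCat.of B B)
    -- The universal extension is transported to the given localization.
    let ε : M ≅ BR := (LinearEquiv.symm { e with map_smul' := he : BR ≃ₗ[R] M }).toModuleIso
    have hE' : (ShortComplex.mk (i ≫ ε.hom) (ε.inv ≫ p) (by simp [w])).ShortExact :=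
      ShortComplex.shortExact_of_iso
        (ShortComplex.isoMk (S₁ := ShortComplex.mk i p w) (Iso.refl _) ε (Iso.refl _) (by simp) (by simp)) hE
    have hperp : IsPerpendicular (RingHom.id R) α BR :=
      (hl.1.isPerpendicular (Y := B)).of_addEquiv (AddEquiv.refl B) fun _ _ => rfl
    have hXB : Subsingleton (Ext X BR 1) := hperp.subsingleton_ext hα hαπ hπ
    refine ⟨hM.isArtinAlgebra hR hl, isTiltingModule_prod hsemi hα hαπ hπ hE' hXX hXB,
      c, _, _, _, hE', hc, fun x => ?_⟩
    -- As `Ext¹(X, B) = 0`, the connecting map `Hom(X, X^c) → Ext¹(X, R)` is onto.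
    obtain ⟨y, hy⟩ := Ext.covariant_sequence_exact₁ X hE' x (Subsingleton.elim _ _) (zero_add 1)
    obtain ⟨f, rfl⟩ := (Ext.mk₀_bijective _ _).2 y
    exact ⟨f, hy.symm⟩
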